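/- Notation. $\mathcal A=\{u+\sigma v: u,v\in\mathbb R\}$, $\sigma^2=1$, are the Lorentz numbers; $e^{u+\sigma v}=\frac{1+\sigma}{2}e^{u+v}+\frac{1-\sigma}{2}e^{u-v}$, $\cosh a=\frac{e^a+e^{-a}}2$, $\sinh a=\frac{e^a-e^{-a}}2$ for $a\in\mathcal A$. $I,J,K$ are the usual quaternion units ($I^2=J^2=K^2=-1$, $IJ=-JI=K$) over $\mathcal A\otimes\mathbb C$, $i$ is the complex unit of the coefficients, $\mathbb H_0=\{p_0+ip_1I+p_2J+ip_3K: p_j\in\mathcal A\}$, $H(\zeta,\zeta')=\sum_j\zeta_j\zeta_j'$, $Spin(2,2)=\{p\in\mathbb H_0: H(p,p)=1\}$, and $\widehat\zeta$ is obtained from $\zeta$ by replacing $\sigma$ by $-\sigma$. The Clifford action of a vector represented by $[Y]$ on a spinor represented by $[\varphi]\in\mathbb H_0$ is $[Y\cdot\varphi]=\sigma i[Y]\widehat{[\varphi]}$, the vectors $e_0,e_1,e_2,e_3$ of an adapted orthonormal frame being represented by $\sigma i1, I, iJ, K$. A smooth map $f$ on an open subset of $\mathcal A$ is conformal if $df(\sigma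 h)=\sigma\,df(h)$; then $df=f'da$ with $da=du+\sigma dv$. Setting. Let $M$ be a surface with a Lorentzian metric, and $E\to M$ a bundle of rank $2$ with a Lorentzian fibre metric and a compatible connection, both oriented in space and in time and with spin structures $\tilde Q_M$, $\tilde Q_E$ (structure groups $Spin''(1,1)=\{\pm(\cosh u+i\sinh u\,I)\}$ and $Spin'(1,1)=\{\pm(\cosh v+\sigma i\sinh v\,I)\}$). Let $\Sigma=\Sigma E\otimes\Sigma M$ be the twisted spinor bundle, associated to $\tilde Q=\tilde Q_E\times_M\tilde Q_M$ and to the left multiplication of $Spin'(1,1)\cdot Spin''(1,1)$ on $\mathbb H_0$, with its spinorial connection $\nabla$ induced by the Levi-Civita connection of $M$ and the connection of $E$, and the Dirac operator $D\varphi=-e_2\cdot\nabla_{e_2}\varphi+e_3\cdot\nabla_{e_3}\varphi$ ($(e_2,e_3)$ an orthonormal frame of $TM$ with $|e_2|^2=-1$, $|e_3|^2=1$). Let $\vec H\in\Gamma(E)$ and let $\varphi\in\Gamma(\Sigma)$ satisfy $D\varphi=\vec H\cdot\varphi$ and $H(\varphi,\varphi)=1$ (so that $\vec H$ is the mean curvature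 vector of the isometric immersion in $\mathbb R^{2,2}$ defined by $\varphi$). Suppose that $\tilde Q$ has a parallel section $\tilde s$ (so $TM$ and $E$ are flat), let $(e_0,e_1)$ and $(e_2,e_3)$ be the corresponding parallel, positively oriented orthonormal frames of $E$ and $TM$ ($|e_0|^2=|e_2|^2=-1$, $|e_1|^2=|e_3|^2=1$), write $\vec H=H_0e_0+H_1e_1$, and let $g=[\varphi]:M\to Spin(2,2)$ be the coordinates of $\varphi$ in $\tilde s$. Let $a=u+\sigma v$ be a special chart adapted to $g$, that is a local parametrization $a:\mathcal U\subset\mathcal A\to M$ in which $g$ is conformal and $H(g',g')\equiv\varepsilon$ with a constant $\varepsilon\in\{1,-1\}$, and let $\psi=\theta_1+\sigma\theta_2:\mathcal U\to\mathcal A$ ($\theta_1,\theta_2$ real-valued) be a conformal map such that, on $\mathcal U$, $$g'g^{-1}=\cosh\psi\, J+i\sinh\psi\, K\qquad\text{or, on all of } \mathcal U,\qquad g'g^{-1}=\sinh\psi\, J+i\cosh\psi\, K.$$ Proposition. There are smooth nowhere vanishing functions $\lambda,\mu:\mathcal U\to\mathbb R$ with $$\frac1\mu=-(\cosh\theta_2\,H_0+\sinh\theta_2\,H_1),\qquad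 \frac1\lambda=-(\sinh\theta_2\,H_0+\cosh\theta_2\,H_1),$$ the metric of $M$ in the chart $a=u+\sigma v$ is $$\varepsilon\,(\lambda^2du^2-\mu^2dv^2),$$ and $\lambda,\mu$ are solutions on $\mathcal U$ of the hyperbolic system $$\partial_u\mu=-\lambda\,\partial_u\theta_2,\qquad \partial_v\lambda=-\mu\,\partial_v\theta_2.$$ -/

import Mathlib

open scoped Manifold ContDiff Topology
open Bundle

noncomputable section

namespace LorentzSpin

/-! ### Lorentz numbers -/

/-- The Lorentz numbers `𝒜 = {u + σ v : u, v ∈ ℝ}`, `σ² = 1`; `u` is `re` and `v` is `im`. -/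
abbrev LNum : Type := QuadraticAlgebra ℝ 1 0

/-- The complexified Lorentz numbers `{u + σ v : u, v ∈ ℂ}`, `σ² = 1`. -/
abbrev CLNum : Type := QuadraticAlgebra ℂ 1 0

/-- The quaternions with coefficients in the complexified Lorentz numbers:
`I² = J² = K² = -1`, `I J = -J I = K`. -/
abbrev HAC : Type := QuaternionAlgebra CLNum (-1) 0 (-1)

/-- The real linear identification `u + σ v ↦ (u, v)`. -/
def LNum.toProd : LNum →ₗ[ℝ] ℝ × ℝ where
  toFun a := (a.re, a.im)
  map_add' _ _ := rfl
  map_smul' _ _ := rfl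

theorem LNum.toProd_injective : Function.Injective LNum.toProd := by
  intro a b h
  exact QuadraticAlgebra.ext (congrArg Prod.fst h) (congrArg Prod.snd h)

/-- `𝒜` as the real plane with coordinates `(u, v)` (a norm is fixed only to do calculus). -/
instance : NormedAddCommGroup LNum :=
  NormedAddCommGroup.induced LNum (ℝ × ℝ) LNum.toProd LNum.toProd_injective

instance : NormedSpace ℝ LNum := NormedSpace.induced ℝ LNum (ℝ × ℝ) LNum.toProd

/-- The real linear identification of the quaternions over `CLNum` with `ℂ⁸`. -/
def HAC.toProd : HAC →ₗ[ℝ] (ℂ × ℂ) × (ℂ × ℂ) × (ℂ × ℂ) × (ℂ × ℂ) where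
  toFun q := ((q.re.re, q.re.im), (q.imI.re, q.imI.im), (q.imJ.re, q.imJ.im), (q.imK.re, q.imK.im))
  map_add' _ _ := rfl
  map_smul' _ _ := rfl

theorem HAC.toProd_injective : Function.Injective HAC.toProd := by
  intro p q h
  have hp : ∀ r : HAC, HAC.toProd r = ((r.re.re, r.re.im), (r.imI.re, r.imI.im),
      (r.imJ.re, r.imJ.im), (r.imK.re, r.imK.im)) := fun _ ↦ rfl
  rw [hp, hp] at h
  simp only [Prod.mk.injEq] at h
  ext
  · exact h.1.1
  · exact h.1.2
  · exact h.2.1.1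
  · exact h.2.1.2
  · exact h.2.2.1.1
  · exact h.2.2.1.2
  · exact h.2.2.2.1
  · exact h.2.2.2.2

/-- A norm on this finite dimensional real space, fixed only to do calculus. -/
instance : NormedAddCommGroup HAC :=
  NormedAddCommGroup.induced HAC ((ℂ × ℂ) × (ℂ × ℂ) × (ℂ × ℂ) × (ℂ × ℂ))
    HAC.toProd HAC.toProd_injective

instance : NormedSpace ℝ HAC :=
  NormedSpace.induced ℝ HAC ((ℂ × ℂ) × (ℂ × ℂ) × (ℂ × ℂ) × (ℂ × ℂ)) HAC.toProd

/-- The element `σ` of `𝒜`. -/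
def sg : LNum := ⟨0, 1⟩

/-- The exponential of `𝒜`: `e^{u + σ v} = (1+σ)/2 e^{u+v} + (1-σ)/2 e^{u-v}`. -/
def LNum.exp (a : LNum) : LNum :=
  ⟨(Real.exp (a.re + a.im) + Real.exp (a.re - a.im)) / 2,
    (Real.exp (a.re + a.im) - Real.exp (a.re - a.im)) / 2⟩

def LNum.cosh (a : LNum) : LNum := (1 / 2 : ℝ) • (LNum.exp a + LNum.exp (-a))

def LNum.sinh (a : LNum) : LNum := (1 / 2 : ℝ) • (LNum.exp a - LNum.exp (-a))

/-- The inclusion of `𝒜` in its complexification. -/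
def LNum.toC (a : LNum) : CLNum := ⟨(a.re : ℂ), (a.im : ℂ)⟩

/-- The inclusion of `𝒜` in the quaternions over `CLNum`. -/
def LNum.toH (a : LNum) : HAC := (LNum.toC a : HAC)

/-! ### The quaternionic model of the Clifford algebra of `ℝ^{2,2}` -/

/-- The scalar `σ`. -/
def qs : HAC := LNum.toH sg

/-- The scalar complex unit `i` (distinct from the quaternion unit `I`). -/
def qi : HAC := ((⟨Complex.I, 0⟩ : CLNum) : HAC)

def qI : HAC := ⟨0, 1, 0, 0⟩

def qJ : HAC := ⟨0, 0, 1, 0⟩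

def qK : HAC := ⟨0, 0, 0, 1⟩

/-- `a = u + σ v ↦ â = u - σ v`. -/
def CLNum.hat (a : CLNum) : CLNum := ⟨a.re, -a.im⟩

/-- `ζ ↦ ζ̂`, coefficientwise. -/
def HAC.hat (q : HAC) : HAC :=
  ⟨CLNum.hat q.re, CLNum.hat q.imI, CLNum.hat q.imJ, CLNum.hat q.imK⟩

/-- `ℍ₀ = {p₀ 1 + i p₁ I + p₂ J + i p₃ K : p₀, p₁, p₂, p₃ ∈ 𝒜}`. -/
def H0set : Set HAC :=
  {p | ∃ p0 p1 p2 p3 : LNum,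
    p = LNum.toH p0 + qi * LNum.toH p1 * qI + LNum.toH p2 * qJ + qi * LNum.toH p3 * qK}

/-- The bilinear form `H(ζ,ζ') = ζ₀ζ₀' + ζ₁ζ₁' + ζ₂ζ₂' + ζ₃ζ₃'`. -/
def formH (p q : HAC) : CLNum :=
  p.re * q.re + p.imI * q.imI + p.imJ * q.imJ + p.imK * q.imK

/-- `Spin(2,2) = {p ∈ ℍ₀ : H(p,p) = 1}`. -/
def Spin22 : Set HAC := {p | p ∈ H0set ∧ formH p p = 1}

/-- The Clifford action of the vector represented by `y ∈ ℍ₁` on the spinor represented by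
`ξ ∈ ℍ₀`: `[Y · φ] = σ i [Y] [φ]^`. The canonical basis `e₀, e₁, e₂, e₃` of `ℝ^{2,2}` is
represented by `σ i 1, I, i J, K`. -/
def clif (y ξ : HAC) : HAC := qs * qi * y * HAC.hat ξ

/-! ### The spin groups of `ℝ^{1,1}`

The group `Spin(1,1)` is `{± e^v : v ∈ ℝ}`, i.e. the multiplicative group of the nonzero real
numbers. The two copies of it in `Spin(2,2)` are the images of the following maps.
-/

/-- `Spin'(1,1) = {± (cosh v + σ i sinh v I)}`, with `± e^v ↦ ± (cosh v + σ i sinh v I)`. -/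
def spinE (r : ℝˣ) : HAC :=
  ((((r : ℝ) + (r : ℝ)⁻¹) / 2 : ℝ) • (1 : HAC)) + ((((r : ℝ) - (r : ℝ)⁻¹) / 2 : ℝ) • (qs * qi * qI))

/-- `Spin''(1,1) = {± (cosh u + i sinh u I)}`, with `± e^u ↦ ± (cosh u + i sinh u I)`. -/
def spinM (r : ℝˣ) : HAC :=
  ((((r : ℝ) + (r : ℝ)⁻¹) / 2 : ℝ) • (1 : HAC)) + ((((r : ℝ) - (r : ℝ)⁻¹) / 2 : ℝ) • (qi * qI))

/-! ### Lorentzian bundles of rank two over a surface -/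

/-- The model of the surface; the surface itself is a manifold modelled on it. -/
abbrev Plane : Type := EuclideanSpace ℝ (Fin 2)

section Bundles

variable {M : Type*} [TopologicalSpace M] [ChartedSpace Plane M]
  (F : Type*) [NormedAddCommGroup F] [NormedSpace ℝ F]
  (V : M → Type*) [TopologicalSpace (TotalSpace F V)]
  [∀ x, AddCommGroup (V x)] [∀ x, Module ℝ (V x)] [∀ x, TopologicalSpace (V x)]
  [∀ x, IsTopologicalAddGroup (V x)] [∀ x, ContinuousSMul ℝ (V x)]
  [FiberBundle F V] [VectorBundle ℝ F V]

/-- A smooth fibre metric of signature `(1,1)` on a vector bundle (of rank two). -/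
structure LorentzMetric where
  inner : ∀ x, V x →L[ℝ] V x →L[ℝ] ℝ
  symm : ∀ x (v w : V x), inner x v w = inner x w v
  signature : ∀ x, ∃ e f : V x, inner x e e = -1 ∧ inner x f f = 1 ∧ inner x e f = 0 ∧
    ∀ v : V x, ∃ α β : ℝ, v = α • e + β • f
  smooth : ContMDiff (𝓡 2) ((𝓡 2).prod 𝓘(ℝ, F →L[ℝ] F →L[ℝ] ℝ)) ∞
    (fun x ↦ TotalSpace.mk' (F →L[ℝ] F →L[ℝ] ℝ) x (inner x))

variable {F V}

/-- Smoothness of a section on a set. -/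
def SmoothSection (F : Type*) [NormedAddCommGroup F] [NormedSpace ℝ F]
    {V : M → Type*} [TopologicalSpace (TotalSpace F V)] [∀ x, TopologicalSpace (V x)]
    [FiberBundle F V] (s : ∀ x, V x) (W : Set M) : Prop :=
  ContMDiffOn (𝓡 2) ((𝓡 2).prod 𝓘(ℝ, F)) ∞ (fun x ↦ (⟨x, s x⟩ : TotalSpace F V)) W

/-- An orientation in space and in time of a Lorentzian bundle of rank two: a reduction of the
bundle of its orthonormal frames `(e, f)`, with `⟨e,e⟩ = -1` and `⟨f,f⟩ = 1`, to the identity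
component of the Lorentz group. `IsPos x e f` says that `(e, f)` is a positively oriented
(in space and in time) orthonormal basis at `x`. -/
structure SpaceTimeOrientation (h : LorentzMetric F V) where
  IsPos : ∀ x, V x → V x → Prop
  orthonormal : ∀ x e f, IsPos x e f →
    h.inner x e e = -1 ∧ h.inner x f f = 1 ∧ h.inner x e f = 0
  orbit : ∀ x e f, IsPos x e f → ∀ e' f', IsPos x e' f' ↔
    ∃ t : ℝ, e' = Real.cosh t • e + Real.sinh t • f ∧ f' = Real.sinh t • e + Real.cosh t • f
  local_frame : ∀ x₀, ∃ W : Set M, IsOpen W ∧ x₀ ∈ W ∧ ∃ e f : ∀ x, V x,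
    SmoothSection F e W ∧ SmoothSection F f W ∧ ∀ x ∈ W, IsPos x (e x) (f x)

/-- The bundle of the positively oriented orthonormal frames. -/
structure PosFrame {h : LorentzMetric F V} (o : SpaceTimeOrientation h) where
  base : M
  e : V base
  f : V base
  pos : o.IsPos base e f

/-- The topology of the frame bundle, as a subspace of the product of two copies of the bundle. -/
instance {h : LorentzMetric F V} (o : SpaceTimeOrientation h) : TopologicalSpace (PosFrame o) :=
  TopologicalSpace.induced
    (fun s ↦ ((⟨s.base, s.e⟩ : TotalSpace F V), (⟨s.base, s.f⟩ : TotalSpace F V))) inferInstance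

/-- The Lorentz rotation of angle `t` of a frame. -/
def PosFrame.rot {h : LorentzMetric F V} {o : SpaceTimeOrientation h} (s : PosFrame o) (t : ℝ) :
    PosFrame o where
  base := s.base
  e := Real.cosh t • s.e + Real.sinh t • s.f
  f := Real.sinh t • s.e + Real.cosh t • s.f
  pos := (o.orbit s.base s.e s.f s.pos _ _).2 ⟨t, rfl, rfl⟩

/-- A spin structure: a principal bundle `P` with structure group `Spin(1,1) = {± e^v}` (which is
commutative, so that its right action is written as a left one), with a double covering of the
bundle of the positively oriented orthonormal frames; `± e^v` acts on the frames as the Lorentz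
rotation of angle `-2v`. -/
structure SpinStructure {h : LorentzMetric F V} (o : SpaceTimeOrientation h)
    (P : Type*) [TopologicalSpace P] [MulAction ℝˣ P] where
  continuous_smul : Continuous (fun q : ℝˣ × P ↦ q.1 • q.2)
  toFrame : P → PosFrame o
  isCoveringMap : IsCoveringMap toFrame
  surjective : Function.Surjective toFrame
  equivariant : ∀ (r : ℝˣ) (p : P), toFrame (r • p) = (toFrame p).rot (-2 * Real.log |(r : ℝ)|)
  neg_ne : ∀ p : P, (-1 : ℝˣ) • p ≠ p
  fibre : ∀ p q : P, toFrame p = toFrame q ↔ (q = p ∨ q = (-1 : ℝˣ) • p)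

/-- Compatibility of a connection with the fibre metric:
`X⟨s,t⟩ = ⟨∇_X s, t⟩ + ⟨s, ∇_X t⟩`. -/
def IsMetricConnection (h : LorentzMetric F V) (cov : CovariantDerivative (𝓡 2) F V) : Prop :=
  ∀ (s t : ∀ x, V x) (x : M) (X : TangentSpace (𝓡 2) x),
    MDifferentiableAt (𝓡 2) ((𝓡 2).prod 𝓘(ℝ, F)) (fun y ↦ (⟨y, s y⟩ : TotalSpace F V)) x →
    MDifferentiableAt (𝓡 2) ((𝓡 2).prod 𝓘(ℝ, F)) (fun y ↦ (⟨y, t y⟩ : TotalSpace F V)) x →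
    mvfderiv (𝓡 2) (fun y ↦ h.inner y (s y) (t y)) x X
      = h.inner x (cov s x X) (t x) + h.inner x (s x) (cov t x X)

end Bundles

section Surface

variable {M : Type*} [TopologicalSpace M] [ChartedSpace Plane M] [IsManifold (𝓡 2) ∞ M]

/-- The tangent bundle, as a family of vector spaces. -/
abbrev TB (M : Type*) [TopologicalSpace M] [ChartedSpace Plane M] (x : M) : Type :=
  TangentSpace (𝓡 2) x

/-- The Levi-Civita connection of a Lorentzian metric on the surface. -/
def IsLeviCivita (g : LorentzMetric Plane (TB M))
    (cov : CovariantDerivative (𝓡 2) Plane (TB M)) : Prop :=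
  IsMetricConnection g cov ∧ cov.torsion = 0

variable {F : Type*} [NormedAddCommGroup F] [NormedSpace ℝ F]
  {E : M → Type*} [TopologicalSpace (TotalSpace F E)]
  [∀ x, AddCommGroup (E x)] [∀ x, Module ℝ (E x)] [∀ x, TopologicalSpace (E x)]
  [∀ x, IsTopologicalAddGroup (E x)] [∀ x, ContinuousSMul ℝ (E x)]
  [FiberBundle F E] [VectorBundle ℝ F E]
  {gE : LorentzMetric F E} {oE : SpaceTimeOrientation gE}
  {gM : LorentzMetric Plane (TB M)} {oM : SpaceTimeOrientation gM}
  {PE : Type*} [TopologicalSpace PE] [MulAction ℝˣ PE]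
  {PM : Type*} [TopologicalSpace PM] [MulAction ℝˣ PM]

/-- The bundle `Q̃ = Q̃_E ×_M Q̃_M` of the spinorial frames. -/
structure SpinFrame (SE : SpinStructure oE PE) (SM : SpinStructure oM PM) where
  pE : PE
  pM : PM
  base_eq : (SE.toFrame pE).base = (SM.toFrame pM).base

variable {SE : SpinStructure oE PE} {SM : SpinStructure oM PM}

/-- The topology of `Q̃`, as a subspace of the product. -/
instance : TopologicalSpace (SpinFrame SE SM) :=
  TopologicalSpace.induced (fun s ↦ (s.pE, s.pM)) inferInstance

/-- The action of `Spin'(1,1) × Spin''(1,1)` on `Q̃`. -/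
def SpinFrame.act (s : SpinFrame SE SM) (r₁ r₂ : ℝˣ) : SpinFrame SE SM where
  pE := r₁ • s.pE
  pM := r₂ • s.pM
  base_eq := by
    rw [SE.equivariant, SM.equivariant]
    exact s.base_eq

variable (SE SM) in
/-- A local section `s̃` of `Q̃` over `W`, together with the frames `(e₀, e₁)` of `E` and
`(e₂, e₃)` of `TM` such that `π(s̃) = (e₀, e₁, e₂, e₃)` over `W`. -/
structure LocalSpinFrame (W : Set M) where
  lift : M → SpinFrame SE SM
  e0 : ∀ x, E x
  e1 : ∀ x, E x
  e2 : ∀ x, TB M x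
  e3 : ∀ x, TB M x
  lift_continuousOn : ContinuousOn lift W
  smooth0 : SmoothSection F e0 W
  smooth1 : SmoothSection F e1 W
  smooth2 : SmoothSection Plane e2 W
  smooth3 : SmoothSection Plane e3 W
  lift_E : ∀ x ∈ W, ∃ h : oE.IsPos x (e0 x) (e1 x), SE.toFrame (lift x).pE = ⟨x, e0 x, e1 x, h⟩
  lift_M : ∀ x ∈ W, ∃ h : oM.IsPos x (e2 x) (e3 x), SM.toFrame (lift x).pM = ⟨x, e2 x, e3 x, h⟩

/-- A section of `Q̃` is parallel if its frames of `E` and of `TM` are parallel. -/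
def LocalSpinFrame.IsParallel {W : Set M} (s : LocalSpinFrame SE SM W)
    (covE : CovariantDerivative (𝓡 2) F E) (covM : CovariantDerivative (𝓡 2) Plane (TB M)) :
    Prop :=
  ∀ x ∈ W, covE s.e0 x = 0 ∧ covE s.e1 x = 0 ∧ covM s.e2 x = 0 ∧ covM s.e3 x = 0

variable (SE SM) in
/-- A smooth section `φ` of the twisted spinor bundle `Σ = ΣE ⊗ ΣM = Q̃ × ℍ₀ / ρ`, given by the
equivariant function which to a spinorial frame associates the coordinates of `φ` in this frame:
`φ = [s̃, φ(s̃)] = [s̃ h, h⁻¹ φ(s̃)]` for `h = h₁ h₂ ∈ Spin'(1,1) · Spin''(1,1)`. -/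
structure SpinorField where
  toFun : SpinFrame SE SM → HAC
  mem_H0 : ∀ s, toFun s ∈ H0set
  equivariant : ∀ s (r₁ r₂ : ℝˣ), spinE r₁ * spinM r₂ * toFun (s.act r₁ r₂) = toFun s
  smooth : ∀ (W : Set M), IsOpen W → ∀ s : LocalSpinFrame SE SM W,
    ContMDiffOn (𝓡 2) 𝓘(ℝ, HAC) ∞ (fun x ↦ toFun (s.lift x)) W

/-- The coordinates `[φ]` of a spinor field in a local section `s̃` of `Q̃`. -/
def SpinorField.coord (φ : SpinorField SE SM) {W : Set M} (s : LocalSpinFrame SE SM W) (x : M) :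
    HAC :=
  φ.toFun (s.lift x)

/-- The coordinates in `s̃` of the spinorial covariant derivative `∇_X φ` at a point of `W`:
`[∇_X φ] = d[φ](X) - ½ ⟨∇_X e₀, e₁⟩ [e₀ · e₁] [φ] - ½ ⟨∇_X e₂, e₃⟩ [e₂ · e₃] [φ]`
with `[e₀ · e₁] = σ i I` and `[e₂ · e₃] = i I`. -/
def SpinorField.cov (φ : SpinorField SE SM)
    (covE : CovariantDerivative (𝓡 2) F E) (covM : CovariantDerivative (𝓡 2) Plane (TB M))
    {W : Set M} (s : LocalSpinFrame SE SM W) (x : M) (X : TB M x) : HAC :=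
  mvfderiv (𝓡 2) (φ.coord s) x X
    - (gE.inner x (covE s.e0 x X) (s.e1 x) / 2 : ℝ) • (qs * qi * qI * φ.coord s x)
    - (gM.inner x (covM s.e2 x X) (s.e3 x) / 2 : ℝ) • (qi * qI * φ.coord s x)

/-- The first coordinate `H₀` of a section `H₀ e₀ + H₁ e₁` of `E`. -/
def LocalSpinFrame.coord0 {W : Set M} (s : LocalSpinFrame SE SM W) (Hv : ∀ x, E x) (x : M) : ℝ :=
  -gE.inner x (Hv x) (s.e0 x)

/-- The second coordinate `H₁` of a section `H₀ e₀ + H₁ e₁` of `E`. -/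
def LocalSpinFrame.coord1 {W : Set M} (s : LocalSpinFrame SE SM W) (Hv : ∀ x, E x) (x : M) : ℝ :=
  gE.inner x (Hv x) (s.e1 x)

/-- The Dirac equation `Dφ = -e₂ · ∇_{e₂} φ + e₃ · ∇_{e₃} φ = H⃗ · φ`, written in all the local
spinorial frames. -/
def SpinorField.SolvesDirac (φ : SpinorField SE SM)
    (covE : CovariantDerivative (𝓡 2) F E) (covM : CovariantDerivative (𝓡 2) Plane (TB M))
    (Hv : ∀ x, E x) : Prop :=
  ∀ (W : Set M), IsOpen W → ∀ s : LocalSpinFrame SE SM W, ∀ x ∈ W,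
    -clif (qi * qJ) (φ.cov covE covM s x (s.e2 x)) + clif qK (φ.cov covE covM s x (s.e3 x))
      = clif (s.coord0 Hv x • (qs * qi) + s.coord1 Hv x • qI) (φ.coord s x)

end Surface

/-! ### Conformal maps on Lorentz numbers, and special charts -/

/-- Conformal maps on an open subset `U` of `𝒜`: smooth maps with `df(σ h) = σ df(h)`. -/
def IsConformalLNum (f : LNum → LNum) (U : Set LNum) : Prop :=
  ContDiffOn ℝ ∞ f U ∧ ∀ z ∈ U, ∀ h : LNum, fderiv ℝ f z (sg * h) = sg * fderiv ℝ f z h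

/-- Conformal maps from an open subset `U` of `𝒜` with values in the quaternions. -/
def IsConformalHAC (f : LNum → HAC) (U : Set LNum) : Prop :=
  ContDiffOn ℝ ∞ f U ∧ ∀ z ∈ U, ∀ h : LNum, fderiv ℝ f z (sg * h) = qs * fderiv ℝ f z h

/-- The derivative `f'` of a conformal map: `df = f' da` with `da = du + σ dv`, so `f' = ∂_u f`. -/
def derivHAC (f : LNum → HAC) (z : LNum) : HAC := fderiv ℝ f z 1

/-- `∂_u f`, where `a = u + σ v` is the coordinate on `𝒜`. -/
def du (f : LNum → ℝ) (z : LNum) : ℝ := fderiv ℝ f z 1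

/-- `∂_v f`, where `a = u + σ v` is the coordinate on `𝒜`. -/
def dv (f : LNum → ℝ) (z : LNum) : ℝ := fderiv ℝ f z sg

/-- A special chart `a = u + σ v`, from an open subset of `𝒜` to `M`, adapted to a map `g` on `M`:
a smooth local parametrization in which `g` is conformal, with `H(g',g') ≡ ε`, `ε = ±1`. -/
structure IsSpecialChart {M : Type*} [TopologicalSpace M] [ChartedSpace Plane M]
    (g : M → HAC) (a : OpenPartialHomeomorph LNum M) (ε : ℝ) : Prop where
  sign : ε = 1 ∨ ε = -1
  smooth : ContMDiffOn 𝓘(ℝ, LNum) (𝓡 2) ∞ a a.source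
  smooth_symm : ContMDiffOn (𝓡 2) 𝓘(ℝ, LNum) ∞ a.symm a.target
  conformal : IsConformalHAC (g ∘ a) a.source
  normalized : ∀ z ∈ a.source,
    formH (derivHAC (g ∘ a) z) (derivHAC (g ∘ a) z) = ⟨(ε : ℂ), 0⟩

/-- The conformal map `ψ : U ⊂ 𝒜 → 𝒜` associated with a map `g` on `U`:
`g' g⁻¹ = cosh ψ J + i sinh ψ K` on `U`, or `g' g⁻¹ = sinh ψ J + i cosh ψ K` on `U`
(for `g` with values in `Spin(2,2)`, the inverse of `g` is its quaternionic conjugate `star g`). -/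
def IsAngle (g : LNum → HAC) (ψ : LNum → LNum) (U : Set LNum) : Prop :=
  IsConformalLNum ψ U ∧
  ((∀ z ∈ U, derivHAC g z * star (g z) =
      LNum.toH (LNum.cosh (ψ z)) * qJ + qi * LNum.toH (LNum.sinh (ψ z)) * qK) ∨
   (∀ z ∈ U, derivHAC g z * star (g z) =
      LNum.toH (LNum.sinh (ψ z)) * qJ + qi * LNum.toH (LNum.cosh (ψ z)) * qK))

end LorentzSpin

end

open LorentzSpin

namespace LorentzSpin

open scoped QuadraticAlgebra

/-! In a parallel frame the spinorial derivative is the plain differential of g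
(`SpinorField.cov_of_parallel`), and by conformality this differential is h ↦ h g' for h in 𝒜. Let
x₂, x₃ ∈ 𝒜 be the chart coordinates of e₂, e₃ and write g'g⁻¹ = PJ + iQK. Once g is cancelled, the
Dirac equation is the linear system x₂P − x₃Q = −σH₀, x₂Q − x₃P = H₁
(`SpinorField.SolvesDirac.coordinates`). Since P² − Q² = ±1, it can be solved: with A, B the
prescribed values of 1/λ, 1/μ, the frame is, up to exchange and signs, f₂ = A sinh θ₁ + σB cosh θ₁,
f₃ = A cosh θ₁ + σB sinh θ₁.

Thus A∂_u and B∂_v arise from an orthonormal frame by a hyperbolic rotation, which gives both the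
nonvanishing of A, B and the metric (`metric_of_orthonormal`); the exchange occurs exactly when ε =
−1.

Parallel fields of a torsion-free connection commute, and [f₂, f₃] = 0 amounts to A²∂_uθ₁ = B∂_vA
and B²∂_vθ₁ = A∂_uB. The Cauchy-Riemann equations of ψ trade θ₁ for θ₂, and the result is the system
for λ = 1/A, μ = 1/B (`hyperbolic_system`). -/

/-! ### Quaternion algebra: the hat, conjugation and the form H. -/

theorem CLNum.hat_mul (p q : CLNum) : CLNum.hat (p * q) = CLNum.hat p * CLNum.hat q := by
  ext <;> simp [CLNum.hat]; ring

theorem CLNum.hat_add (p q : CLNum) : CLNum.hat (p + q) = CLNum.hat p + CLNum.hat q := by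
  ext <;> simp [CLNum.hat]; ring

theorem CLNum.hat_neg (p : CLNum) : CLNum.hat (-p) = -CLNum.hat p := by
  ext <;> simp [CLNum.hat]

theorem HAC.hat_mul (p q : HAC) : HAC.hat (p * q) = HAC.hat p * HAC.hat q := by
  apply QuaternionAlgebra.ext <;>
    simp [HAC.hat, CLNum.hat_mul, CLNum.hat_add, CLNum.hat_neg, sub_eq_add_neg]

/-- The hat is multiplicative, so a right factor leaves the Clifford action as its hat. This is what
allows g to be cancelled from the Dirac equation. -/
theorem clif_mul_right (y p q : HAC) : clif y (p * q) = clif y p * HAC.hat q := by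
  simp only [clif, HAC.hat_mul, mul_assoc]

theorem star_mul_self_of_formH {q : HAC} (h : formH q q = 1) : star q * q = 1 := by
  have h1 := congrArg QuadraticAlgebra.re h
  have h2 := congrArg QuadraticAlgebra.im h
  simp [formH] at h1 h2
  ext <;> simp <;> first | linear_combination h1 | linear_combination h2 | ring

theorem mul_star_self_of_formH {q : HAC} (h : formH q q = 1) : q * star q = 1 := by
  have h1 := congrArg QuadraticAlgebra.re h
  have h2 := congrArg QuadraticAlgebra.im h
  simp [formH] at h1 h2
  ext <;> simp <;> first | linear_combination h1 | linear_combination h2 | ring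

/-- Euler's four-square identity, valid over any commutative ring. -/
theorem formH_mul_self (p q : HAC) : formH (p * q) (p * q) = formH p p * formH q q := by
  ext <;> simp [formH] <;> ring

/-! ### The Dirac equation as a linear system over 𝒜. -/

/-- The Dirac equation in a parallel frame, after right multiplication by the inverse of the
(conjugated) spinor, in terms of the coordinates `x2`, `x3` of the frame vectors. -/
theorem dirac_coordinates {x2 x3 P Q : LNum} {H0 H1 : ℝ}
    (h : -clif (qi * qJ) (x2.toH * (P.toH * qJ + qi * Q.toH * qK))
      + clif qK (x3.toH * (P.toH * qJ + qi * Q.toH * qK))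
      = clif (H0 • (qs * qi) + H1 • qI) 1) :
    x2 * P - x3 * Q = -(H0 • sg) ∧ x2 * Q - x3 * P = H1 • 1 := by
  -- Products of J, K with J, K lie in the span of 1 and I. The scalar part is real and the I part
  -- is purely imaginary over 𝒜, so these four components contain the whole equation.
  have h1 := congrArg (fun q : HAC ↦ q.re.re.re) h
  have h2 := congrArg (fun q : HAC ↦ q.re.im.re) h
  have h3 := congrArg (fun q : HAC ↦ q.imI.re.im) h
  have h4 := congrArg (fun q : HAC ↦ q.imI.im.im) h
  simp [clif, HAC.hat, CLNum.hat, LNum.toH, LNum.toC, qs, qi, qI, qJ, qK, sg] at h1 h2 h3 h4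
  constructor <;> ext <;> simp [sg]
  · linear_combination -h2
  · linear_combination h1
  · linear_combination h4
  · linear_combination -h3

/-- Addition formula together with cosh(σv) = cosh v and sinh(σv) = σ sinh v. -/
theorem LNum.cosh_eq (a : LNum) :
    a.cosh = ⟨Real.cosh a.re * Real.cosh a.im, Real.sinh a.re * Real.sinh a.im⟩ := by
  ext <;> simp [LNum.cosh, LNum.exp, Real.cosh_eq, Real.sinh_eq, Real.exp_add, Real.exp_sub,
    Real.exp_neg] <;> field_simp <;> ring

theorem LNum.sinh_eq (a : LNum) :
    a.sinh = ⟨Real.sinh a.re * Real.cosh a.im, Real.cosh a.re * Real.sinh a.im⟩ := by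
  ext <;> simp [LNum.sinh, LNum.exp, Real.cosh_eq, Real.sinh_eq, Real.exp_add, Real.exp_sub,
    Real.exp_neg] <;> field_simp <;> ring

theorem LNum.cosh_sq_sub_sinh_sq (a : LNum) : a.cosh * a.cosh - a.sinh * a.sinh = 1 := by
  have h1 := Real.cosh_sq a.re
  have h2 := Real.cosh_sq a.im
  ext <;> simp [LNum.cosh_eq, LNum.sinh_eq]
  · linear_combination (Real.cosh a.im ^ 2 - Real.sinh a.im ^ 2) * h1 + h2
  · ring

/-- The frame vectors in the chart, when `g' g⁻¹ = cosh ψ J + i sinh ψ K`. -/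
theorem frame_coordinates_cosh {x2 x3 p : LNum} {H0 H1 : ℝ}
    (h1 : x2 * p.cosh - x3 * p.sinh = -(H0 • sg)) (h2 : x2 * p.sinh - x3 * p.cosh = H1 • 1) :
    x2 = ⟨-(Real.sinh p.im * H0 + Real.cosh p.im * H1) * Real.sinh p.re,
        -(Real.cosh p.im * H0 + Real.sinh p.im * H1) * Real.cosh p.re⟩ ∧
    x3 = ⟨-(Real.sinh p.im * H0 + Real.cosh p.im * H1) * Real.cosh p.re,
        -(Real.cosh p.im * H0 + Real.sinh p.im * H1) * Real.sinh p.re⟩ := by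
  have h := p.cosh_sq_sub_sinh_sq
  -- Cramer's rule: the determinant is sinh² − cosh² = −1, a unit, so the zero divisors of 𝒜 do no
  -- harm.
  have e2 : x2 = -(H0 • sg) * p.cosh - (H1 • 1) * p.sinh := by
    linear_combination p.cosh * h1 - p.sinh * h2 - x2 * h
  have e3 : x3 = -(H0 • sg) * p.sinh - (H1 • 1) * p.cosh := by
    linear_combination p.sinh * h1 - p.cosh * h2 - x3 * h
  rw [e2, e3]
  constructor <;> ext <;> simp [sg, LNum.cosh_eq, LNum.sinh_eq] <;> ring

/-- The frame vectors in the chart, when `g' g⁻¹ = sinh ψ J + i cosh ψ K`. -/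
theorem frame_coordinates_sinh {x2 x3 p : LNum} {H0 H1 : ℝ}
    (h1 : x2 * p.sinh - x3 * p.cosh = -(H0 • sg)) (h2 : x2 * p.cosh - x3 * p.sinh = H1 • 1) :
    x2 = -⟨-(Real.sinh p.im * H0 + Real.cosh p.im * H1) * Real.cosh p.re,
        -(Real.cosh p.im * H0 + Real.sinh p.im * H1) * Real.sinh p.re⟩ ∧
    x3 = -⟨-(Real.sinh p.im * H0 + Real.cosh p.im * H1) * Real.sinh p.re,
        -(Real.cosh p.im * H0 + Real.sinh p.im * H1) * Real.cosh p.re⟩ := by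
  have h := p.cosh_sq_sub_sinh_sq
  have e2 : x2 = (H0 • sg) * p.sinh + (H1 • 1) * p.cosh := by
    linear_combination p.cosh * h2 - p.sinh * h1 - x2 * h
  have e3 : x3 = (H0 • sg) * p.cosh + (H1 • 1) * p.sinh := by
    linear_combination p.sinh * h2 - p.cosh * h1 - x3 * h
  rw [e2, e3]
  constructor <;> ext <;> simp [sg, LNum.cosh_eq, LNum.sinh_eq] <;> ring

/-- The minus sign comes from (iQ)² = −Q². -/
theorem formH_angle (P Q : LNum) :
    formH (P.toH * qJ + qi * Q.toH * qK) (P.toH * qJ + qi * Q.toH * qK)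
      = (P * P - Q * Q).toC := by
  ext <;> simp [formH, LNum.toH, LNum.toC, qi, qJ, qK, Complex.ext_iff] <;> ring

/-! ### Calculus in the plane of Lorentz numbers. -/

instance : FiniteDimensional ℝ LNum :=
  FiniteDimensional.of_injective LNum.toProd LNum.toProd_injective

instance : CompleteSpace LNum := FiniteDimensional.complete ℝ LNum

noncomputable def LNum.reCLM : LNum →L[ℝ] ℝ :=
  LinearMap.toContinuousLinearMap (LinearMap.fst ℝ ℝ ℝ ∘ₗ LNum.toProd)

noncomputable def LNum.imCLM : LNum →L[ℝ] ℝ :=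
  LinearMap.toContinuousLinearMap (LinearMap.snd ℝ ℝ ℝ ∘ₗ LNum.toProd)

theorem LNum.reCLM_apply (a : LNum) : LNum.reCLM a = a.re := rfl

theorem LNum.imCLM_apply (a : LNum) : LNum.imCLM a = a.im := rfl

theorem LNum.eq_smul_add_smul (h : LNum) : h = h.re • (1 : LNum) + h.im • sg := by
  ext <;> simp [sg]

theorem LNum.mk_eq (x y : ℝ) : (⟨x, y⟩ : LNum) = x • (1 : LNum) + y • sg :=
  LNum.eq_smul_add_smul ⟨x, y⟩

/-- A real function of a Lorentz variable has differential `∂_u f du + ∂_v f dv`. -/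
theorem fderiv_apply_eq (f : LNum → ℝ) (z h : LNum) :
    fderiv ℝ f z h = h.re * du f z + h.im * dv f z := by
  conv_lhs => rw [LNum.eq_smul_add_smul h]
  rw [map_add, map_smul, map_smul]
  rfl

/-- The Cauchy-Riemann equations of a conformal map. -/
theorem IsConformalLNum.cauchyRiemann {f : LNum → LNum} {U : Set LNum} (hU : IsOpen U)
    (hf : IsConformalLNum f U) {z : LNum} (hz : z ∈ U) :
    du (fun w ↦ (f w).re) z = dv (fun w ↦ (f w).im) z ∧
    dv (fun w ↦ (f w).re) z = du (fun w ↦ (f w).im) z := by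
  have hd : DifferentiableAt ℝ f z :=
    (hf.1.contDiffAt (hU.mem_nhds hz)).differentiableAt (by simp)
  have h1 : fderiv ℝ (fun w ↦ (f w).re) z = LNum.reCLM.comp (fderiv ℝ f z) :=
    (LNum.reCLM.hasFDerivAt.comp z hd.hasFDerivAt).fderiv
  have h2 : fderiv ℝ (fun w ↦ (f w).im) z = LNum.imCLM.comp (fderiv ℝ f z) :=
    (LNum.imCLM.hasFDerivAt.comp z hd.hasFDerivAt).fderiv
  have h3 := hf.2 z hz 1
  -- Conformality at h = 1 says ∂_v f = σ ∂_u f, and σ exchanges the two components.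
  rw [mul_one] at h3
  simp only [du, dv, h1, h2, ContinuousLinearMap.comp_apply, h3, LNum.reCLM_apply,
    LNum.imCLM_apply]
  simp [sg]

/-- The commutation of the fields `A sinh t ∂_u + B cosh t ∂_v` and
`A cosh t ∂_u + B sinh t ∂_v`. -/
theorem system_of_lieBracket_eq_zero {A B t : LNum → ℝ} {z : LNum} (hA : DifferentiableAt ℝ A z)
    (hB : DifferentiableAt ℝ B z) (ht : DifferentiableAt ℝ t z)
    (h : VectorField.lieBracket ℝ
      (fun w ↦ (A w * Real.sinh (t w)) • (1 : LNum) + (B w * Real.cosh (t w)) • sg)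
      (fun w ↦ (A w * Real.cosh (t w)) • (1 : LNum) + (B w * Real.sinh (t w)) • sg) z = 0) :
    A z ^ 2 * du t z = B z * dv A z ∧ B z ^ 2 * dv t z = A z * du B z := by
  have hs := ht.hasFDerivAt.sinh
  have hc := ht.hasFDerivAt.cosh
  have d2 := (((hA.hasFDerivAt.mul hs).smul_const (1 : LNum)).add
    ((hB.hasFDerivAt.mul hc).smul_const sg)).fderiv
  have d3 := (((hA.hasFDerivAt.mul hc).smul_const (1 : LNum)).add
    ((hB.hasFDerivAt.mul hs).smul_const sg)).fderiv
  have hre := congrArg QuadraticAlgebra.re h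
  have him := congrArg QuadraticAlgebra.im h
  simp only [VectorField.lieBracket] at hre him
  erw [d2, d3] at hre him
  simp [fderiv_apply_eq, sg] at hre him
  -- In each component of the bracket the sinh·cosh terms cancel, and what remains carries the
  -- factor cosh² − sinh².
  have hh := Real.cosh_sq (t z)
  constructor
  · linear_combination (-1) * hre - (A z ^ 2 * du t z - B z * dv A z) * hh
  · linear_combination him - (B z ^ 2 * dv t z - A z * du B z) * hh

theorem du_inv {f : LNum → ℝ} {z : LNum} (hf : DifferentiableAt ℝ f z) (h : f z ≠ 0) :
    du (fun w ↦ (f w)⁻¹) z = -du f z / f z ^ 2 := by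
  have := ((hasDerivAt_inv h).comp_hasFDerivAt z hf.hasFDerivAt).fderiv
  change fderiv ℝ (Inv.inv ∘ f) z 1 = _
  rw [this]
  simp [du]
  ring

theorem dv_inv {f : LNum → ℝ} {z : LNum} (hf : DifferentiableAt ℝ f z) (h : f z ≠ 0) :
    dv (fun w ↦ (f w)⁻¹) z = -dv f z / f z ^ 2 := by
  have := ((hasDerivAt_inv h).comp_hasFDerivAt z hf.hasFDerivAt).fderiv
  change fderiv ℝ (Inv.inv ∘ f) z sg = _
  rw [this]
  simp [dv]
  ring

/-- A real linear map commuting with σ is 𝒜-linear, hence determined by its value at 1. -/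
theorem fderiv_of_isConformalHAC {g : LNum → HAC} {U : Set LNum} (hg : IsConformalHAC g U)
    {z : LNum} (hz : z ∈ U) (h : LNum) : fderiv ℝ g z h = h.toH * derivHAC g z := by
  have h1 := hg.2 z hz 1
  rw [mul_one] at h1
  conv_lhs => rw [LNum.eq_smul_add_smul h]
  rw [map_add, map_smul, map_smul, h1]
  change _ • derivHAC g z + _ • (qs * derivHAC g z) = _
  generalize derivHAC g z = q
  ext <;> simp [LNum.toH, LNum.toC, qs, sg]

/-! ### From the surface to the chart. -/

section Surface

variable {M : Type*} [TopologicalSpace M] [ChartedSpace Plane M]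
  {a : OpenPartialHomeomorph LNum M}

/-- Guarantees that the pullbacks of e₂, e₃ to the chart are mapped back to e₂, e₃ by the
differential. -/
theorem mfderiv_isInvertible (ha : ContMDiffOn 𝓘(ℝ, LNum) (𝓡 2) ∞ a a.source)
    (ha' : ContMDiffOn (𝓡 2) 𝓘(ℝ, LNum) ∞ a.symm a.target) {z : LNum} (hz : z ∈ a.source) :
    (mfderiv 𝓘(ℝ, LNum) (𝓡 2) a z).IsInvertible :=
  ⟨OpenPartialHomeomorph.MDifferentiable.mfderiv
    ⟨ha.mdifferentiableOn (by simp), ha'.mdifferentiableOn (by simp)⟩ hz, rfl⟩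

variable {F : Type*} [NormedAddCommGroup F] [NormedSpace ℝ F]
  {E : M → Type*} [TopologicalSpace (TotalSpace F E)]
  [∀ x, AddCommGroup (E x)] [∀ x, Module ℝ (E x)] [∀ x, TopologicalSpace (E x)]
  [FiberBundle F E] [VectorBundle ℝ F E]
  {gE : LorentzMetric F E}

/-- Supplies the smoothness of H₀ and H₁ in the chart, and so of λ and μ. -/
theorem contDiffOn_inner_comp (ha : ContMDiffOn 𝓘(ℝ, LNum) (𝓡 2) ∞ a a.source)
    {v w : ∀ x, E x} (hv : SmoothSection F v Set.univ) (hw : SmoothSection F w Set.univ) :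
    ContDiffOn ℝ ∞ (fun z ↦ gE.inner (a z) (v (a z)) (w (a z))) a.source := by
  have h : ContMDiffOn (𝓡 2) ((𝓡 2).prod 𝓘(ℝ, ℝ)) ∞
      (fun x ↦ TotalSpace.mk' ℝ (E := Bundle.Trivial M ℝ) x (gE.inner x (v x) (w x)))
      Set.univ :=
    ContMDiffOn.clm_bundle_apply₂ (F₁ := F) (F₂ := F) gE.smooth.contMDiffOn hv hw
  have h2 : ContMDiff (𝓡 2) 𝓘(ℝ, ℝ) ∞ (fun x ↦ gE.inner x (v x) (w x)) := by
    intro x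
    have := h.contMDiffAt (x := x) Filter.univ_mem
    rw [Bundle.contMDiffAt_totalSpace] at this
    exact this.2
  exact contMDiffOn_iff_contDiffOn.1 (h2.comp_contMDiffOn ha)

variable [IsManifold (𝓡 2) ∞ M]

/-- Fields that are parallel for a torsion-free connection commute. -/
theorem mlieBracket_eq_zero_of_parallel {cov : CovariantDerivative (𝓡 2) Plane (TB M)}
    (hcov : cov.torsion = 0) {X Y : ∀ x, TB M x} (hX : SmoothSection Plane X Set.univ)
    (hY : SmoothSection Plane Y Set.univ) {x : M} (hX0 : cov X x = 0) (hY0 : cov Y x = 0) :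
    VectorField.mlieBracket (𝓡 2) X Y x = 0 := by
  have h := cov.torsion_apply
    ((hX.contMDiffAt Filter.univ_mem).mdifferentiableAt (x := x) (by simp))
    ((hY.contMDiffAt Filter.univ_mem).mdifferentiableAt (x := x) (by simp))
  rw [hcov, hX0, hY0] at h
  simpa using h.symm

/-- In a parametrization, commuting fields have commuting coordinate expressions. -/
theorem lieBracket_pullback_eq_zero (ha : ContMDiffOn 𝓘(ℝ, LNum) (𝓡 2) ∞ a a.source)
    {X Y : ∀ x, TB M x} (hX : SmoothSection Plane X Set.univ)
    (hY : SmoothSection Plane Y Set.univ) {z : LNum} (hz : z ∈ a.source)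
    (h : VectorField.mlieBracket (𝓡 2) X Y (a z) = 0) :
    VectorField.lieBracket ℝ (fun w ↦ VectorField.mpullback 𝓘(ℝ, LNum) (𝓡 2) a X w : LNum → LNum)
      (fun w ↦ VectorField.mpullback 𝓘(ℝ, LNum) (𝓡 2) a Y w) z = 0 := by
  have : IsManifold (𝓡 2) (minSmoothness ℝ 3) M :=
    IsManifold.of_le (n := ∞) (by rw [minSmoothness_of_isRCLikeNormedField]; exact WithTop.coe_le_coe.2 le_top)
  have h1 := VectorField.mpullback_mlieBracket (𝕜 := ℝ) (I := 𝓘(ℝ, LNum)) (I' := 𝓡 2) (n := ∞)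
    ((hX.contMDiffAt Filter.univ_mem).mdifferentiableAt (x := a z) (by simp))
    ((hY.contMDiffAt Filter.univ_mem).mdifferentiableAt (x := a z) (by simp))
    (ha.contMDiffAt (a.open_source.mem_nhds hz))
    (by rw [minSmoothness_of_isRCLikeNormedField]; exact WithTop.coe_le_coe.2 le_top)
  rw [← VectorField.mlieBracketWithin_univ (I := 𝓘(ℝ, LNum)),
    VectorField.mlieBracketWithin_eq_lieBracketWithin] at h1
  refine Eq.trans (congrFun VectorField.lieBracketWithin_univ z).symm (h1.symm.trans ?_)
  rw [VectorField.mpullback_apply, h]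
  exact map_zero _

variable {oE : SpaceTimeOrientation gE}
  {gM : LorentzMetric Plane (TB M)} {oM : SpaceTimeOrientation gM}
  {PE : Type*} [TopologicalSpace PE] [MulAction ℝˣ PE]
  {PM : Type*} [TopologicalSpace PM] [MulAction ℝˣ PM]
  {SE : SpinStructure oE PE} {SM : SpinStructure oM PM}

theorem LocalSpinFrame.orthonormal_M (s : LocalSpinFrame SE SM Set.univ) (x : M) :
    gM.inner x (s.e2 x) (s.e2 x) = -1 ∧ gM.inner x (s.e3 x) (s.e3 x) = 1 ∧
      gM.inner x (s.e2 x) (s.e3 x) = 0 :=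
  oM.orthonormal x _ _ (s.lift_M x (Set.mem_univ x)).1

/-- The sign of a special chart is the norm of the angle. -/
theorem IsSpecialChart.sign_eq {φ : SpinorField SE SM}
    (hnorm : ∀ s, formH (φ.toFun s) (φ.toFun s) = 1)
    {s : LocalSpinFrame SE SM Set.univ} {ε : ℝ}
    (ha : IsSpecialChart (φ.coord s) a ε) {z : LNum} (hz : z ∈ a.source) {P Q : LNum}
    (hPQ : derivHAC (φ.coord s ∘ a) z * star ((φ.coord s ∘ a) z)
      = P.toH * qJ + qi * Q.toH * qK) : ε = (P * P - Q * Q).re := by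
  have h1 : formH (star (φ.coord s (a z))) (star (φ.coord s (a z))) = 1 := by
    refine Eq.trans ?_ (hnorm (s.lift (a z)))
    simp [formH, SpinorField.coord]
  -- H is multiplicative and the conjugate of g has norm 1, so g' and g'g⁻¹ have the same norm.
  have h2 := formH_mul_self (derivHAC (φ.coord s ∘ a) z) (star ((φ.coord s ∘ a) z))
  rw [hPQ, formH_angle, ha.normalized z hz] at h2
  erw [h1] at h2
  rw [mul_one] at h2
  simpa [LNum.toC] using (congrArg (fun q : CLNum ↦ q.re.re) h2).symm

variable [∀ x, IsTopologicalAddGroup (E x)] [∀ x, ContinuousSMul ℝ (E x)]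

/-- In a parallel frame the spinorial derivative is the derivative of the coordinates. -/
theorem SpinorField.cov_of_parallel (φ : SpinorField SE SM)
    {covE : CovariantDerivative (𝓡 2) F E} {covM : CovariantDerivative (𝓡 2) Plane (TB M)}
    {s : LocalSpinFrame SE SM Set.univ} (hs : s.IsParallel covE covM) (x : M) (X : TB M x) :
    φ.cov covE covM s x X = mvfderiv (𝓡 2) (φ.coord s) x X := by
  obtain ⟨h0, -, h2, -⟩ := hs x (Set.mem_univ x)
  simp [SpinorField.cov, h0, h2]

/-- The Dirac equation in a special chart, in terms of the coordinates of the frame vectors. -/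
theorem SpinorField.SolvesDirac.coordinates {φ : SpinorField SE SM}
    {covE : CovariantDerivative (𝓡 2) F E} {covM : CovariantDerivative (𝓡 2) Plane (TB M)}
    {Hv : ∀ x, E x} (hnorm : ∀ s, formH (φ.toFun s) (φ.toFun s) = 1)
    (hφ : φ.SolvesDirac covE covM Hv)
    {s : LocalSpinFrame SE SM Set.univ} (hs : s.IsParallel covE covM) {ε : ℝ}
    (ha : IsSpecialChart (φ.coord s) a ε) {z : LNum} (hz : z ∈ a.source) {P Q : LNum}
    (hPQ : derivHAC (φ.coord s ∘ a) z * star ((φ.coord s ∘ a) z)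
      = P.toH * qJ + qi * Q.toH * qK) {x2 x3 : LNum}
    (h2 : mfderiv 𝓘(ℝ, LNum) (𝓡 2) a z x2 = s.e2 (a z))
    (h3 : mfderiv 𝓘(ℝ, LNum) (𝓡 2) a z x3 = s.e3 (a z)) :
    x2 * P - x3 * Q = -(s.coord0 Hv (a z) • sg) ∧ x2 * Q - x3 * P = s.coord1 Hv (a z) • 1 := by
  have hg : formH (φ.coord s (a z)) (φ.coord s (a z)) = 1 := hnorm _
  have hgs := star_mul_self_of_formH hg
  have hg' : derivHAC (φ.coord s ∘ a) z
      = (P.toH * qJ + qi * Q.toH * qK) * φ.coord s (a z) := by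
    rw [← hPQ, mul_assoc]
    change _ = _ * (star (φ.coord s (a z)) * φ.coord s (a z))
    rw [hgs, mul_one]
  -- Chain rule through the chart, followed by the 𝒜-linearity of the differential of g ∘ a.
  have hd : ∀ h : LNum, mvfderiv (𝓡 2) (φ.coord s) (a z) (mfderiv 𝓘(ℝ, LNum) (𝓡 2) a z h)
      = h.toH * (P.toH * qJ + qi * Q.toH * qK) * φ.coord s (a z) := by
    intro h
    rw [mul_assoc, ← hg', ← fderiv_of_isConformalHAC ha.conformal hz, ← mfderiv_eq_fderiv]
    have hc : MDifferentiableAt (𝓡 2) 𝓘(ℝ, HAC) (φ.coord s) (a z) :=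
      ((φ.smooth _ isOpen_univ s).contMDiffAt Filter.univ_mem).mdifferentiableAt (by simp)
    exact (mfderiv_comp_apply (I := 𝓘(ℝ, LNum)) (I' := 𝓡 2) (I'' := 𝓘(ℝ, HAC))
      (g := φ.coord s) (f := a) z hc
      ((ha.smooth.contMDiffAt (a.open_source.mem_nhds hz)).mdifferentiableAt (by simp)) h).symm
  have hD := hφ _ isOpen_univ s (a z) (Set.mem_univ _)
  have hr : ∀ y p : HAC, clif y (p * φ.coord s (a z)) * HAC.hat (star (φ.coord s (a z)))
      = clif y p := by
    intro y p
    rw [clif_mul_right, mul_assoc, ← HAC.hat_mul, mul_star_self_of_formH hg]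
    have : HAC.hat 1 = 1 := by ext <;> simp [HAC.hat, CLNum.hat]
    rw [this, mul_one]
  have hr1 := fun y ↦ hr y 1
  simp only [one_mul] at hr1
  rw [φ.cov_of_parallel hs, φ.cov_of_parallel hs, ← h2, ← h3, hd, hd] at hD
  apply dirac_coordinates
  have h4 := congrArg (· * HAC.hat (star (φ.coord s (a z)))) hD
  simpa only [add_mul, neg_mul, hr, hr1] using h4

end Surface

/-! ### The metric and the hyperbolic system. -/

/-- A bilinear form for which `A sinh t + σ B cosh t` and `A cosh t + σ B sinh t` are orthonormal
is diagonal in the basis `1, σ`. -/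
theorem metric_of_orthonormal {b : LNum →L[ℝ] LNum →L[ℝ] ℝ} (hb : ∀ h k, b h k = b k h)
    {A B t ε : ℝ} (hε : ε ≠ 0) {f2 f3 : LNum}
    (hf2 : f2 = (A * Real.sinh t) • (1 : LNum) + (B * Real.cosh t) • sg)
    (hf3 : f3 = (A * Real.cosh t) • (1 : LNum) + (B * Real.sinh t) • sg)
    (h22 : b f2 f2 = -ε) (h33 : b f3 f3 = ε) (h23 : b f2 f3 = 0) :
    A ≠ 0 ∧ B ≠ 0 ∧
      ∀ h k : LNum, b h k = ε * (A⁻¹ ^ 2 * (h.re * k.re) - B⁻¹ ^ 2 * (h.im * k.im)) := by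
  have hh := Real.cosh_sq t
  -- Inverting the hyperbolic rotation: A·1 and B·σ are again orthogonal, with squares ε and −ε. As
  -- ε ≠ 0, neither A nor B can vanish.
  have hA : A • (1 : LNum) = Real.cosh t • f3 - Real.sinh t • f2 := by
    rw [hf2, hf3]
    ext <;> simp [sg] <;> first | linear_combination (-A) * hh | ring
  have hB : B • sg = Real.cosh t • f2 - Real.sinh t • f3 := by
    rw [hf2, hf3]
    ext <;> simp [sg] <;> first | linear_combination (-B) * hh | ring
  have h32 : b f3 f2 = 0 := by rw [hb, h23]
  have e11 : A ^ 2 * b 1 1 = ε := by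
    have : b (A • (1 : LNum)) (A • (1 : LNum)) = ε := by
      rw [hA]
      simp [h22, h33, h23, h32]
      linear_combination ε * hh
    rw [← this]
    simp
    ring
  have e22 : B ^ 2 * b sg sg = -ε := by
    have : b (B • sg) (B • sg) = -ε := by
      rw [hB]
      simp [h22, h33, h23, h32]
      linear_combination -ε * hh
    rw [← this]
    simp
    ring
  have e12 : A * B * b 1 sg = 0 := by
    have : b (A • (1 : LNum)) (B • sg) = 0 := by
      rw [hA, hB]
      simp [h22, h33, h23, h32]
      ring
    refine Eq.trans ?_ this
    simp
    ring
  have hA0 : A ≠ 0 := by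
    rintro rfl
    exact hε (by simpa using e11.symm)
  have hB0 : B ≠ 0 := by
    rintro rfl
    exact hε (by simpa using e22.symm)
  refine ⟨hA0, hB0, fun h k ↦ ?_⟩
  have e12' : b 1 sg = 0 := by simpa [hA0, hB0] using e12
  have e21' : b sg 1 = 0 := by rw [hb, e12']
  have e11' : b 1 1 = ε * A⁻¹ ^ 2 := by field_simp; linear_combination e11
  have e22' : b sg sg = -ε * B⁻¹ ^ 2 := by field_simp; linear_combination e22
  conv_lhs => rw [LNum.eq_smul_add_smul h, LNum.eq_smul_add_smul k]
  simp [e11', e22', e12', e21']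
  ring

/-- The hyperbolic system satisfied by the inverses of `A` and `B`, if the orthonormal fields
`A sinh t ∂_u + B cosh t ∂_v` and `A cosh t ∂_u + B sinh t ∂_v` commute. -/
theorem hyperbolic_system {U : Set LNum} (hU : IsOpen U) {p : LNum → LNum}
    (hp : IsConformalLNum p U) {A B : LNum → ℝ} (hA : ContDiffOn ℝ ∞ A U)
    (hB : ContDiffOn ℝ ∞ B U) {f2 f3 : LNum → LNum}
    (hf2 : ∀ z ∈ U, f2 z = (A z * Real.sinh (p z).re) • (1 : LNum)
      + (B z * Real.cosh (p z).re) • sg)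
    (hf3 : ∀ z ∈ U, f3 z = (A z * Real.cosh (p z).re) • (1 : LNum)
      + (B z * Real.sinh (p z).re) • sg)
    {z : LNum} (hz : z ∈ U) (h : VectorField.lieBracket ℝ f2 f3 z = 0)
    (hA0 : A z ≠ 0) (hB0 : B z ≠ 0) :
    du (fun w ↦ (B w)⁻¹) z = -(A z)⁻¹ * du (fun w ↦ (p w).im) z ∧
      dv (fun w ↦ (A w)⁻¹) z = -(B z)⁻¹ * dv (fun w ↦ (p w).im) z := by
  have hUz := hU.mem_nhds hz
  have hAd := (hA.contDiffAt hUz).differentiableAt (by simp)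
  have hBd := (hB.contDiffAt hUz).differentiableAt (by simp)
  have hpd : DifferentiableAt ℝ (fun w ↦ (p w).re) z :=
    LNum.reCLM.differentiableAt.comp z ((hp.1.contDiffAt hUz).differentiableAt (by simp))
  have e2 := Filter.eventually_of_mem hUz hf2
  have e3 := Filter.eventually_of_mem hUz hf3
  -- The formulas for the fields hold only on U, but the bracket depends only on germs.
  rw [Filter.EventuallyEq.lieBracket_vectorField_eq e2 e3] at h
  obtain ⟨h1, h2⟩ := system_of_lieBracket_eq_zero hAd hBd hpd h
  obtain ⟨c1, c2⟩ := hp.cauchyRiemann hU hz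
  rw [c1] at h1
  rw [c2] at h2
  rw [du_inv hBd hB0, dv_inv hAd hA0]
  constructor
  · field_simp
    linear_combination h2
  · field_simp
    linear_combination h1

end LorentzSpin

/-! ### The proposition. -/

open LorentzSpin
theorem mainTheorem8
    -- the surface, its Lorentzian metric, its orientation in space and time, its connection
    {M : Type*} [TopologicalSpace M] [ChartedSpace Plane M] [IsManifold (𝓡 2) ∞ M]
    (gM : LorentzMetric Plane (TB M)) (oM : SpaceTimeOrientation gM)
    (covM : CovariantDerivative (𝓡 2) Plane (TB M)) (hcovM : IsLeviCivita gM covM)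
    -- the Lorentzian bundle of rank two, oriented in space and time, with compatible connection
    {F : Type*} [NormedAddCommGroup F] [NormedSpace ℝ F]
    {E : M → Type*} [TopologicalSpace (TotalSpace F E)]
    [∀ x, AddCommGroup (E x)] [∀ x, Module ℝ (E x)] [∀ x, TopologicalSpace (E x)]
    [∀ x, IsTopologicalAddGroup (E x)] [∀ x, ContinuousSMul ℝ (E x)]
    [FiberBundle F E] [VectorBundle ℝ F E] [ContMDiffVectorBundle ∞ F E (𝓡 2)]
    (gE : LorentzMetric F E) (oE : SpaceTimeOrientation gE)
    (covE : CovariantDerivative (𝓡 2) F E) (_hcovE : IsMetricConnection gE covE)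
    -- the spin structures
    {PE : Type*} [TopologicalSpace PE] [MulAction ℝˣ PE] (SE : SpinStructure oE PE)
    {PM : Type*} [TopologicalSpace PM] [MulAction ℝˣ PM] (SM : SpinStructure oM PM)
    -- the section `Hv` of `E` and the normalised solution `φ` of the Dirac equation
    (Hv : ∀ x, E x) (hHv : SmoothSection F Hv Set.univ)
    (φ : SpinorField SE SM) (hnorm : ∀ s, formH (φ.toFun s) (φ.toFun s) = 1)
    (hφ : φ.SolvesDirac covE covM Hv)
    -- the parallel section of the bundle of spinorial frames
    (s : LocalSpinFrame SE SM Set.univ) (hs : s.IsParallel covE covM)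
    -- the special chart adapted to `g = [φ]`, and `ψ = θ₁ + σ θ₂`
    (a : OpenPartialHomeomorph LNum M) (ε : ℝ) (ha : IsSpecialChart (φ.coord s) a ε)
    (ψ : LNum → LNum) (hψ : IsAngle (φ.coord s ∘ a) ψ a.source) :
    ∃ lam mu : LNum → ℝ,
      ContDiffOn ℝ ∞ lam a.source ∧ ContDiffOn ℝ ∞ mu a.source ∧
      (∀ z ∈ a.source, lam z ≠ 0 ∧ mu z ≠ 0 ∧
        1 / mu z = -(Real.cosh (ψ z).im * s.coord0 Hv (a z)
          + Real.sinh (ψ z).im * s.coord1 Hv (a z)) ∧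
        1 / lam z = -(Real.sinh (ψ z).im * s.coord0 Hv (a z)
          + Real.cosh (ψ z).im * s.coord1 Hv (a z))) ∧
      (∀ z ∈ a.source, ∀ h k : LNum,
        gM.inner (a z) (mfderiv 𝓘(ℝ, LNum) (𝓡 2) a z h) (mfderiv 𝓘(ℝ, LNum) (𝓡 2) a z k)
          = ε * (lam z ^ 2 * (h.re * k.re) - mu z ^ 2 * (h.im * k.im))) ∧
      (∀ z ∈ a.source,
        du mu z = -lam z * du (fun w ↦ (ψ w).im) z ∧
        dv lam z = -mu z * dv (fun w ↦ (ψ w).im) z) := by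
  have hε : ε ≠ 0 := by rcases ha.sign with h | h <;> simp [h]
  have hψim : ContDiffOn ℝ ∞ (fun z ↦ (ψ z).im) a.source :=
    LNum.imCLM.contDiff.comp_contDiffOn hψ.1.1
  have hH0 : ContDiffOn ℝ ∞ (fun z ↦ s.coord0 Hv (a z)) a.source :=
    (contDiffOn_inner_comp ha.smooth hHv s.smooth0).neg
  have hH1 : ContDiffOn ℝ ∞ (fun z ↦ s.coord1 Hv (a z)) a.source :=
    contDiffOn_inner_comp ha.smooth hHv s.smooth1
  -- A and B are the required values of 1/λ and 1/μ. They are smooth from the start; their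
  -- nonvanishing comes later, from the metric.
  let A : LNum → ℝ := fun z ↦ -(Real.sinh (ψ z).im * s.coord0 Hv (a z)
    + Real.cosh (ψ z).im * s.coord1 Hv (a z))
  let B : LNum → ℝ := fun z ↦ -(Real.cosh (ψ z).im * s.coord0 Hv (a z)
    + Real.sinh (ψ z).im * s.coord1 Hv (a z))
  have hA : ContDiffOn ℝ ∞ A a.source := ((hψim.sinh.mul hH0).add (hψim.cosh.mul hH1)).neg
  have hB : ContDiffOn ℝ ∞ B a.source := ((hψim.cosh.mul hH0).add (hψim.sinh.mul hH1)).neg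
  -- the frame of `TM` in the chart, up to exchange and signs
  let b : ∀ z : LNum, LNum →L[ℝ] LNum →L[ℝ] ℝ := fun z ↦
    let G : Plane →L[ℝ] Plane →L[ℝ] ℝ := gM.inner (a z)
    let L : LNum →L[ℝ] Plane := mfderiv 𝓘(ℝ, LNum) (𝓡 2) a z
    G.bilinearComp L L
  obtain ⟨f2, f3, hf⟩ : ∃ f2 f3 : LNum → LNum, ∀ z ∈ a.source,
      f2 z = (A z * Real.sinh (ψ z).re) • (1 : LNum) + (B z * Real.cosh (ψ z).re) • sg ∧
      f3 z = (A z * Real.cosh (ψ z).re) • (1 : LNum) + (B z * Real.sinh (ψ z).re) • sg ∧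
      b z (f2 z) (f2 z) = -ε ∧ b z (f3 z) (f3 z) = ε ∧ b z (f2 z) (f3 z) = 0 ∧
      VectorField.lieBracket ℝ f2 f3 z = 0 := by
    let x2 : LNum → LNum := fun z ↦ VectorField.mpullback 𝓘(ℝ, LNum) (𝓡 2) a s.e2 z
    let x3 : LNum → LNum := fun z ↦ VectorField.mpullback 𝓘(ℝ, LNum) (𝓡 2) a s.e3 z
    have hx2 : ∀ z ∈ a.source, mfderiv 𝓘(ℝ, LNum) (𝓡 2) a z (x2 z) = s.e2 (a z) :=
      fun z hz ↦ (mfderiv_isInvertible ha.smooth ha.smooth_symm hz).self_apply_inverse _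
    have hx3 : ∀ z ∈ a.source, mfderiv 𝓘(ℝ, LNum) (𝓡 2) a z (x3 z) = s.e3 (a z) :=
      fun z hz ↦ (mfderiv_isInvertible ha.smooth ha.smooth_symm hz).self_apply_inverse _
    have b22 : ∀ z ∈ a.source, b z (x2 z) (x2 z) = -1 := fun z hz ↦ by
      change gM.inner (a z) (mfderiv 𝓘(ℝ, LNum) (𝓡 2) a z (x2 z))
        (mfderiv 𝓘(ℝ, LNum) (𝓡 2) a z (x2 z)) = _
      rw [hx2 z hz, (s.orthonormal_M (a z)).1]
    have b33 : ∀ z ∈ a.source, b z (x3 z) (x3 z) = 1 := fun z hz ↦ by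
      change gM.inner (a z) (mfderiv 𝓘(ℝ, LNum) (𝓡 2) a z (x3 z))
        (mfderiv 𝓘(ℝ, LNum) (𝓡 2) a z (x3 z)) = _
      rw [hx3 z hz, (s.orthonormal_M (a z)).2.1]
    have b23 : ∀ z ∈ a.source, b z (x2 z) (x3 z) = 0 := fun z hz ↦ by
      change gM.inner (a z) (mfderiv 𝓘(ℝ, LNum) (𝓡 2) a z (x2 z))
        (mfderiv 𝓘(ℝ, LNum) (𝓡 2) a z (x3 z)) = _
      rw [hx2 z hz, hx3 z hz, (s.orthonormal_M (a z)).2.2]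
    have b32 : ∀ z ∈ a.source, b z (x3 z) (x2 z) = 0 := fun z hz ↦
      (gM.symm _ _ _).trans (b23 z hz)
    have hlie : ∀ z ∈ a.source, VectorField.lieBracket ℝ x2 x3 z = 0 := fun z hz ↦
      lieBracket_pullback_eq_zero ha.smooth s.smooth2 s.smooth3 hz
        (mlieBracket_eq_zero_of_parallel hcovM.2 s.smooth2 s.smooth3
          (hs (a z) (Set.mem_univ _)).2.2.1 (hs (a z) (Set.mem_univ _)).2.2.2)
    rcases hψ.2 with h | h
    · refine ⟨x2, x3, fun z hz ↦ ?_⟩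
      -- The sign is read off at a point of the chart domain, which might be empty.
      have hεz : ε = 1 := by
        rw [ha.sign_eq hnorm hz (h z hz), LNum.cosh_sq_sub_sinh_sq]
        rfl
      obtain ⟨h1, h2⟩ := hφ.coordinates hnorm hs ha hz (h z hz) (hx2 z hz) (hx3 z hz)
      obtain ⟨c2, c3⟩ := frame_coordinates_cosh h1 h2
      refine ⟨?_, ?_, ?_, ?_, b23 z hz, hlie z hz⟩
      · rw [c2]
        exact LNum.mk_eq _ _
      · rw [c3]
        exact LNum.mk_eq _ _
      · rw [b22 z hz, hεz]
      · rw [b33 z hz, hεz]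
    -- Here the solution has cosh θ₁ and sinh θ₁ exchanged and a global sign. Taking f₂ = −x₃, f₃ =
    -- −x₂ restores the common form, with squares 1 = −ε and −1 = ε.
    · refine ⟨fun z ↦ -x3 z, fun z ↦ -x2 z, fun z hz ↦ ?_⟩
      have hεz : ε = -1 := by
        rw [ha.sign_eq hnorm hz (h z hz), ← neg_sub, LNum.cosh_sq_sub_sinh_sq]
        rfl
      obtain ⟨h1, h2⟩ := hφ.coordinates hnorm hs ha hz (h z hz) (hx2 z hz) (hx3 z hz)
      obtain ⟨c2, c3⟩ := frame_coordinates_sinh h1 h2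
      refine ⟨?_, ?_, ?_, ?_, ?_, ?_⟩
      · change -x3 z = _
        rw [c3, neg_neg]
        exact LNum.mk_eq _ _
      · change -x2 z = _
        rw [c2, neg_neg]
        exact LNum.mk_eq _ _
      · simp [b33 z hz, hεz]
      · simp [b22 z hz, hεz]
      · simp [b32 z hz]
      -- The two signs cancel in the bracket and the exchange only reverses it: [−x₃, −x₂] = −[x₂,
      -- x₃] = 0.
      · have := hlie z hz
        simp only [VectorField.lieBracket, fderiv_fun_neg, sub_eq_zero] at this ⊢
        simpa using this.symm
  have hmet : ∀ z ∈ a.source, _ := fun z hz ↦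
    metric_of_orthonormal (b := b z) (fun _ _ ↦ gM.symm _ _ _) hε (hf z hz).1 (hf z hz).2.1
      (hf z hz).2.2.1 (hf z hz).2.2.2.1 (hf z hz).2.2.2.2.1
  refine ⟨fun z ↦ (A z)⁻¹, fun z ↦ (B z)⁻¹, hA.inv fun z hz ↦ (hmet z hz).1,
    hB.inv fun z hz ↦ (hmet z hz).2.1, fun z hz ↦ ⟨inv_ne_zero (hmet z hz).1,
      inv_ne_zero (hmet z hz).2.1, ?_, ?_⟩, fun z hz h k ↦ (hmet z hz).2.2 h k,
    fun z hz ↦ hyperbolic_system a.open_source hψ.1 hA hB (fun z hz ↦ (hf z hz).1)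
      (fun z hz ↦ (hf z hz).2.1) hz (hf z hz).2.2.2.2.2 (hmet z hz).1 (hmet z hz).2.1⟩
  · rw [one_div, inv_inv]
  · rw [one_div, inv_inv]
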